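/- Let $\mathcal M=\mathbb R^{2n}$ be the phase space of pairs $X=(P,Q)$ with the symplectic form $\omega((P,Q),(P',Q'))=\sum_j(P_jQ'_j-P'_jQ_j)$, and let $\mathcal L_k\subset\mathcal M$ be a $k$-dimensional isotropic subspace with skew-orthogonal complement $\mathcal L_k^{\perp\omega}=\{Y:\omega(X,Y)=0\ \forall X\in\mathcal L_k\}$ and a nonzero translation-invariant (Haar) measure $\mu$ on $\mathcal L_k$. On the Schwartz space $\mathcal S(\mathbb R^n)$ (complex-valued functions) put $\Omega(P,Q)=\sum_j\bigl(P_j\xi_j-Q_j\tfrac1i\tfrac{\partial}{\partial\xi_j}\bigr)$ and $(\psi,\varphi)=\int\psi^*\varphi\,d\xi$, and define $$\langle\psi,\varphi\rangle=\int_{\mathcal L_k}d\mu(X)\,(\psi,e^{i\Omega(X)}\varphi),\qquad f_1\sim f_2\iff\langle f_1-f_2,f_1-f_2\rangle=0 .$$ For subspaces $\mathcal A,\mathcal B\subset\mathcal M$ let $\mathrm{Sym}\,\mathcal A\otimes\mathcal B\subset\mathcal M\otimes\mathcal M$ be the span of the tensors $x\otimes y+y\otimes x$ with $x\in\mathcal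 A$, $y\in\mathcal B$, and let $\Omega_2$ be the real-linear map from $\mathcal M\otimes\mathcal M$ to operators on $\mathcal S(\mathbb R^n)$ with $\Omega_2(Z\otimes Z')=\Omega(Z)\Omega(Z')$. Let $H=\Omega_2(\Gamma)+\varepsilon$ with $\Gamma\in\mathrm{Sym}\,\mathcal M\otimes\mathcal M$ and $\varepsilon\in\mathbb R$. Then: 1. $H$ preserves the equivalence relation (i.e. $f_1\sim f_2$ implies $Hf_1\sim Hf_2$ for all $f_1,f_2\in\mathcal S(\mathbb R^n)$) if and only if $\Gamma\in\mathrm{Sym}\,\mathcal L_k^{\perp\omega}\otimes\mathcal L_k^{\perp\omega}+\mathrm{Sym}\,\mathcal L_k\otimes\mathcal M$. 2. If $H$ preserves the equivalence relation, then there exist $\Gamma'\in\mathrm{Sym}\,\mathcal L_k^{\perp\omega}\otimes\mathcal L_k^{\perp\omega}$ and a constant $\varepsilon'\in\mathbb C$ with $\mathrm{Re}\,\varepsilon'=\varepsilon$ such that $Hf\sim[\Omega_2(\Gamma')+\varepsilon']f$ for all $f\in\mathcal S(\mathbb R^n)$. -/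

import Mathlib

open scoped SchwartzMap LineDeriv TensorProduct ComplexConjugate
open MeasureTheory

noncomputable section

namespace ConstrainedQuadratic

/-- Configuration space `ℝⁿ` of the variable `ξ`. -/
abbrev Config (n : ℕ) : Type := EuclideanSpace ℝ (Fin n)

/-- Classical phase space `ℝ²ⁿ` of pairs `X = (P, Q)`. -/
abbrev PhaseSpace (n : ℕ) : Type := Config n × Config n

/-- Wave functions: the Schwartz space `𝓢(ℝⁿ)`. -/
abbrev Wave (n : ℕ) : Type := 𝓢(Config n, ℂ)

/-- The symplectic form `ω((P,Q),(P',Q')) = ∑ⱼ (Pⱼ Q'ⱼ - P'ⱼ Qⱼ)`. -/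
def symp (n : ℕ) : LinearMap.BilinForm ℝ (PhaseSpace n) :=
  LinearMap.mk₂ ℝ (fun X Y => ∑ j, (X.1 j * Y.2 j - Y.1 j * X.2 j))
    (fun X X' Y => by
      rw [← Finset.sum_add_distrib]
      refine Finset.sum_congr rfl fun j _ => ?_
      simp only [Prod.fst_add, Prod.snd_add, PiLp.add_apply]
      ring)
    (fun c X Y => by
      rw [smul_eq_mul, Finset.mul_sum]
      refine Finset.sum_congr rfl fun j _ => ?_
      simp only [Prod.smul_fst, Prod.smul_snd, PiLp.smul_apply, smul_eq_mul]
      ring)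
    (fun X Y Y' => by
      rw [← Finset.sum_add_distrib]
      refine Finset.sum_congr rfl fun j _ => ?_
      simp only [Prod.fst_add, Prod.snd_add, PiLp.add_apply]
      ring)
    (fun c X Y => by
      rw [smul_eq_mul, Finset.mul_sum]
      refine Finset.sum_congr rfl fun j _ => ?_
      simp only [Prod.smul_fst, Prod.smul_snd, PiLp.smul_apply, smul_eq_mul]
      ring)

/-- A plane on which `ω` vanishes. -/
def IsIsotropic {n : ℕ} (L : Submodule ℝ (PhaseSpace n)) : Prop :=
  ∀ X ∈ L, ∀ Y ∈ L, symp n X Y = 0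

/-- The skew-orthogonal complement of `L` with respect to `ω`. -/
def skewOrth {n : ℕ} (L : Submodule ℝ (PhaseSpace n)) : Submodule ℝ (PhaseSpace n) :=
  L.orthogonalBilin (symp n)

/-- The coordinate operator: multiplication by `ξⱼ`. -/
def coordOp {n : ℕ} (j : Fin n) : Module.End ℂ (Wave n) :=
  (SchwartzMap.smulLeftCLM ℂ (fun ξ : Config n => ((ξ j : ℝ) : ℂ))).toLinearMap

/-- The momentum operator `(1/i) ∂/∂ξⱼ`. -/
def momOp {n : ℕ} (j : Fin n) : Module.End ℂ (Wave n) :=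
  (1 / Complex.I) •
    (LineDeriv.lineDerivOpCLM ℂ (Wave n) (EuclideanSpace.single j (1 : ℝ))).toLinearMap

theorem coordOp_apply {n : ℕ} (j : Fin n) (f : Wave n) (ξ : Config n) :
    coordOp j f ξ = (ξ j : ℂ) * f ξ := by
  have h : Function.HasTemperateGrowth (fun ξ : Config n => ((ξ j : ℝ) : ℂ)) :=
    (Complex.ofRealCLM.comp (EuclideanSpace.proj j : Config n →L[ℝ] ℝ)).hasTemperateGrowth
  simp [coordOp, SchwartzMap.smulLeftCLM_apply_apply h]

theorem momOp_apply {n : ℕ} (j : Fin n) (f : Wave n) (ξ : Config n) :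
    momOp j f ξ = (1 / Complex.I) * fderiv ℝ f ξ (EuclideanSpace.single j (1 : ℝ)) := by
  simp [momOp, SchwartzMap.lineDerivOp_apply_eq_fderiv]

/-- `Ω(P,Q) = ∑ⱼ (Pⱼ ξⱼ - Qⱼ (1/i) ∂/∂ξⱼ)`, as an operator on the Schwartz space which depends
linearly on `(P,Q)`. -/
def Omega (n : ℕ) : PhaseSpace n →ₗ[ℝ] Module.End ℂ (Wave n) where
  toFun X := ∑ j, (X.1 j • coordOp j - X.2 j • momOp j)
  map_add' X Y := by
    rw [← Finset.sum_add_distrib]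
    refine Finset.sum_congr rfl fun j _ => ?_
    simp only [Prod.fst_add, Prod.snd_add, PiLp.add_apply, add_smul]
    abel
  map_smul' c X := by
    rw [Finset.smul_sum]
    refine Finset.sum_congr rfl fun j _ => ?_
    simp only [Prod.smul_fst, Prod.smul_snd, PiLp.smul_apply, smul_eq_mul, mul_smul, smul_sub,
      RingHom.id_apply]

theorem Omega_apply {n : ℕ} (X : PhaseSpace n) (f : Wave n) (ξ : Config n) :
    Omega n X f ξ = ∑ j, ((X.1 j : ℂ) * ((ξ j : ℂ) * f ξ)
      - (X.2 j : ℂ) * ((1 / Complex.I) * fderiv ℝ f ξ (EuclideanSpace.single j (1 : ℝ)))) := by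
  simp [Omega, coordOp_apply, momOp_apply, LinearMap.sum_apply, Finset.sum_add_distrib]

/-- The Weyl operator `e^{iΩ(X)}`, `X = (P,Q)`:
`(e^{iΩ(X)} f)(ξ) = e^{i (P·ξ - P·Q/2)} f(ξ - Q)`. -/
def weyl {n : ℕ} (X : PhaseSpace n) (f : Config n → ℂ) (ξ : Config n) : ℂ :=
  Complex.exp (Complex.I * ((∑ j, X.1 j * ξ j - (1 / 2) * ∑ j, X.1 j * X.2 j : ℝ) : ℂ))
    * f (ξ - X.2)

/-- The Weyl relation `e^{iΩ(X)} e^{iΩ(Y)} = e^{iΩ(X+Y)} e^{(i/2) ω(X,Y)}`. In particular,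
`t ↦ e^{iΩ(tX)}` is a one-parameter group. -/
theorem weyl_weyl {n : ℕ} (X Y : PhaseSpace n) (f : Config n → ℂ) (ξ : Config n) :
    weyl X (weyl Y f) ξ
      = Complex.exp ((Complex.I / 2) * (symp n X Y : ℂ)) * weyl (X + Y) f ξ := by
  have h : ξ - X.2 - Y.2 = ξ - (X + Y).2 := by simp [sub_sub]
  simp only [weyl]
  rw [h, ← mul_assoc, ← mul_assoc, ← Complex.exp_add, ← Complex.exp_add]
  congr 2
  have : (∑ j, X.1 j * ξ j - (1 / 2) * ∑ j, X.1 j * X.2 j)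
      + (∑ j, Y.1 j * (ξ - X.2) j - (1 / 2) * ∑ j, Y.1 j * Y.2 j)
      = (1 / 2) * symp n X Y
        + (∑ j, (X + Y).1 j * ξ j - (1 / 2) * ∑ j, (X + Y).1 j * (X + Y).2 j) := by
    simp only [symp, LinearMap.mk₂_apply, Finset.mul_sum, ← Finset.sum_sub_distrib,
      ← Finset.sum_add_distrib]
    refine Finset.sum_congr rfl fun j _ => ?_
    simp only [Prod.fst_add, Prod.snd_add, PiLp.add_apply, PiLp.sub_apply]
    ring
  rw [← mul_add, ← Complex.ofReal_add, this]
  push_cast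
  ring

/-- The generator of the one-parameter group `t ↦ e^{iΩ(tX)}` is `iΩ(X)`. -/
theorem hasDerivAt_weyl {n : ℕ} (X : PhaseSpace n) (f : Wave n) (ξ : Config n) :
    HasDerivAt (fun t : ℝ => weyl (t • X) f ξ) (Complex.I * Omega n X f ξ) 0 := by
  have h1 : HasDerivAt (fun t : ℝ => Complex.I *
      ((t * (∑ j, X.1 j * ξ j) - t ^ 2 * ((1 / 2) * ∑ j, X.1 j * X.2 j) : ℝ) : ℂ))
      (Complex.I * ((∑ j, X.1 j * ξ j : ℝ) : ℂ)) 0 := by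
    have h := ((hasDerivAt_id (0 : ℝ)).mul_const (∑ j, X.1 j * ξ j)).sub
      (((hasDerivAt_id (0 : ℝ)).pow 2).mul_const ((1 / 2) * ∑ j, X.1 j * X.2 j))
    have h' := (h.ofReal_comp).const_mul Complex.I
    convert! h' using 1
    simp
  have h2 : HasDerivAt (fun t : ℝ => f (ξ - t • X.2)) (-(fderiv ℝ f ξ X.2)) 0 := by
    have hline : HasDerivAt (fun t : ℝ => ξ - t • X.2) (-X.2) 0 := by
      simpa using ((hasDerivAt_id (0 : ℝ)).smul_const X.2).const_sub ξ
    have hf : HasFDerivAt f (fderiv ℝ f ξ) (ξ - (0 : ℝ) • X.2) := by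
      simpa using f.differentiableAt.hasFDerivAt (x := ξ)
    have h := hf.comp_hasDerivAt (0 : ℝ) hline
    rw [map_neg] at h
    exact h
  have h3 := h1.cexp.mul h2
  have hX : X.2 = ∑ j, X.2 j • EuclideanSpace.single j (1 : ℝ) := by
    ext i
    simp [Finset.sum_apply, Pi.single_apply]
  have hfd : fderiv ℝ f ξ X.2
      = ∑ j, (X.2 j : ℂ) * fderiv ℝ f ξ (EuclideanSpace.single j (1 : ℝ)) := by
    conv_lhs => rw [hX]
    simp [map_sum]
  convert! h3 using 1
  · funext t
    simp only [weyl, Prod.smul_fst, Prod.smul_snd, PiLp.smul_apply, smul_eq_mul, Pi.mul_apply]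
    congr 5
    · rw [Finset.mul_sum]
      exact Finset.sum_congr rfl fun j _ => by ring
    · simp only [Finset.mul_sum]
      exact Finset.sum_congr rfl fun j _ => by ring
  · have e : Complex.exp (Complex.I * (((0 : ℝ) * ∑ j, X.1 j * ξ j
        - (0 : ℝ) ^ 2 * ((1 / 2) * ∑ j, X.1 j * X.2 j) : ℝ) : ℂ)) = 1 := by simp
    rw [e, Omega_apply, hfd, Finset.sum_sub_distrib, mul_sub, zero_smul, sub_zero, one_mul,
      one_mul, sub_eq_add_neg]
    push_cast
    simp only [Finset.sum_mul, Finset.mul_sum]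
    congr 1
    · exact Finset.sum_congr rfl fun j _ => by ring
    · rw [← Finset.sum_neg_distrib, ← Finset.sum_neg_distrib]
      refine Finset.sum_congr rfl fun j _ => ?_
      field_simp

/-- The usual inner product `(ψ,φ) = ∫ ψ* φ dξ`. -/
def waveInner {n : ℕ} (ψ φ : Config n → ℂ) : ℂ := ∫ ξ, conj (ψ ξ) * φ ξ

/-- The inner product `⟨ψ,φ⟩ = ∫_L dμ(X) (ψ, e^{iΩ(X)} φ)` of the constrained system. -/
def physInner {n : ℕ} (L : Submodule ℝ (PhaseSpace n)) (μ : Measure L) (ψ φ : Wave n) : ℂ :=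
  ∫ X : L, waveInner ψ (weyl (X : PhaseSpace n) φ) ∂μ

/-- `f₁ ∼ f₂` iff `f₁ - f₂` has zero norm. -/
def GaugeEquiv {n : ℕ} (L : Submodule ℝ (PhaseSpace n)) (μ : Measure L) (f₁ f₂ : Wave n) : Prop :=
  physInner L μ (f₁ - f₂) (f₁ - f₂) = 0

/-- The operator `H` takes equivalent states to equivalent states. -/
def PreservesEquiv {n : ℕ} (L : Submodule ℝ (PhaseSpace n)) (μ : Measure L)
    (H : Module.End ℂ (Wave n)) : Prop :=
  ∀ f₁ f₂ : Wave n, GaugeEquiv L μ f₁ f₂ → GaugeEquiv L μ (H f₁) (H f₂)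

/-- The space `Sym A ⊗ B` of symmetrized tensors: the span of `x ⊗ y + y ⊗ x` with `x ∈ A` and
`y ∈ B`. -/
def symTensor {n : ℕ} (A B : Submodule ℝ (PhaseSpace n)) :
    Submodule ℝ (PhaseSpace n ⊗[ℝ] PhaseSpace n) :=
  Submodule.span ℝ {t | ∃ x ∈ A, ∃ y ∈ B, t = x ⊗ₜ[ℝ] y + y ⊗ₜ[ℝ] x}

/-- `Sym M ⊗ M` consists of all tensors fixed by the flip `x ⊗ y ↦ y ⊗ x`. -/
theorem mem_symTensor_top {n : ℕ} (Γ : PhaseSpace n ⊗[ℝ] PhaseSpace n) :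
    Γ ∈ symTensor (n := n) ⊤ ⊤ ↔ TensorProduct.comm ℝ _ _ Γ = Γ := by
  constructor
  · intro h
    induction h using Submodule.span_induction with
    | mem t ht =>
      obtain ⟨x, -, y, -, rfl⟩ := ht
      simp [add_comm]
    | zero => simp
    | add s t _ _ hs ht => rw [map_add, hs, ht]
    | smul c t _ ht => rw [map_smul, ht]
  · intro h
    have key : ∀ T : PhaseSpace n ⊗[ℝ] PhaseSpace n,
        T + TensorProduct.comm ℝ _ _ T ∈ symTensor (n := n) ⊤ ⊤ := by
      intro T
      induction T using TensorProduct.induction_on with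
      | zero => simp
      | tmul x y =>
        exact Submodule.subset_span ⟨x, trivial, y, trivial, by simp⟩
      | add s t hs ht =>
        rw [map_add, add_add_add_comm]
        exact add_mem hs ht
    have h2 := Submodule.smul_mem _ (1 / 2 : ℝ) (key Γ)
    rw [h, ← two_smul ℝ Γ, smul_smul] at h2
    simpa using h2

/-- The linear map `Ω₂` with `Ω₂(Z ⊗ Z') = Ω(Z) Ω(Z')`, so that
`Ω₂(½ ∑ Γᵢⱼ Zᵢ ⊗ Zⱼ) = ½ ∑ Γᵢⱼ Ω(Zᵢ) Ω(Zⱼ)`. -/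
def Omega₂ (n : ℕ) : PhaseSpace n ⊗[ℝ] PhaseSpace n →ₗ[ℝ] Module.End ℂ (Wave n) :=
  TensorProduct.lift ((LinearMap.mul ℝ (Module.End ℂ (Wave n))).compl₁₂ (Omega n) (Omega n))

/-- The quadratic Hamiltonian `H = Ω₂(Γ) + ε` with a real number `ε`. -/
def quadHam {n : ℕ} (Γ : PhaseSpace n ⊗[ℝ] PhaseSpace n) (ε : ℝ) : Module.End ℂ (Wave n) :=
  Omega₂ n Γ + (ε : ℂ) • (1 : Module.End ℂ (Wave n))

end ConstrainedQuadratic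

end

noncomputable section

namespace ConstrainedQuadratic

open Filter Topology

variable {n : ℕ}

/-! `physInner` is a positive semidefinite Hermitian form, so by Cauchy–Schwarz
(`physInner_eq_zero_of_self`) the equivalence classes are the cosets of a linear subspace,
`nullSpace`, and preserving equivalence means mapping `nullSpace` into itself. The integrals over
`L` converge because matrix coefficients of Weyl operators decay rapidly
(`exists_pow_mul_norm_waveInner_le`). Positivity comes from squared norms of Gaussian averages over
`L`, in the limit of wide Gaussians (`re_integral_exp_mul_nonneg`).

Three facts about linear observables then decide everything. For `Z ∈ skewOrth L`, `Ω(Z)` is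
symmetric for `physInner` and hence preserves `nullSpace`. For `X ∈ L`, the range of `Ω(X)` lies in
`nullSpace`, because the integrand is a derivative along `L`. Only elements of `L` have this second
property (`mem_of_Omega_mem_nullSpace`).

Sufficiency: in `x ⊗ y + y ⊗ x` with `x ∈ L`, commuting `Ω(x)` to the left leaves an imaginary
constant modulo null vectors; this is also the origin of `ε'`. Necessity: for `X ∈ L` the commutator
of `H` with `Ω(X)` has null range and is a multiple of `Ω(contract X Γ)`, so `contract X Γ ∈ L`;
linear algebra (`mem_sup_of_contract_mem`) turns this into the decomposition of `Γ`. -/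

/-! ### Weyl operators and their matrix coefficients -/

theorem norm_weyl (X : PhaseSpace n) (f : Config n → ℂ) (ξ : Config n) :
    ‖weyl X f ξ‖ = ‖f (ξ - X.2)‖ := by
  rw [weyl, norm_mul, mul_comm Complex.I, Complex.norm_exp_ofReal_mul_I, one_mul]

theorem weyl_zero (f : Config n → ℂ) : weyl (0 : PhaseSpace n) f = f := by
  funext ξ
  simp [weyl]

theorem conj_waveInner (g f : Config n → ℂ) : conj (waveInner g f) = waveInner f g := by
  rw [waveInner, waveInner, ← integral_conj]
  refine integral_congr_ae (.of_forall fun ξ => ?_)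
  simp [mul_comm]

/-- The adjoint of `e^{iΩ(X)}` is `e^{-iΩ(X)}`. -/
theorem waveInner_weyl_left (X : PhaseSpace n) (g f : Config n → ℂ) :
    waveInner (weyl X g) f = waveInner g (weyl (-X) f) := by
  rw [waveInner, waveInner,
    ← integral_add_right_eq_self (fun ξ => conj (weyl X g ξ) * f ξ) X.2]
  refine integral_congr_ae (.of_forall fun ξ => ?_)
  simp only [weyl, map_mul, ← Complex.exp_conj, Complex.conj_I, Complex.conj_ofReal,
    add_sub_cancel_right, Prod.fst_neg, Prod.snd_neg, sub_neg_eq_add, PiLp.neg_apply,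
    PiLp.add_apply]
  rw [mul_comm (Complex.exp _), mul_assoc]
  congr 3
  rw [neg_mul, ← mul_neg]
  congr 1
  push_cast
  simp only [mul_add, Finset.sum_add_distrib, neg_mul, mul_neg, neg_neg, Finset.sum_neg_distrib]
  ring

theorem conj_waveInner_weyl (X : PhaseSpace n) (g f : Config n → ℂ) :
    conj (waveInner g (weyl X f)) = waveInner f (weyl (-X) g) := by
  rw [conj_waveInner, waveInner_weyl_left]

theorem symp_self (X : PhaseSpace n) : symp n X X = 0 := by
  simp [symp]

theorem symp_swap (X Y : PhaseSpace n) : symp n X Y = -symp n Y X := by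
  simp only [symp, LinearMap.mk₂_apply, ← Finset.sum_neg_distrib]
  exact Finset.sum_congr rfl fun j _ => by ring

theorem weyl_weyl_of_symp_eq_zero {X Y : PhaseSpace n} (h : symp n X Y = 0) (f : Config n → ℂ) :
    weyl X (weyl Y f) = weyl (X + Y) f := by
  funext ξ
  simp [weyl_weyl, h]

/-- The derivative of `t ↦ e^{iΩ(X)} e^{iΩ(tZ)} f` at an arbitrary time. -/
theorem hasDerivAt_weyl_weyl (X Z : PhaseSpace n) (f : Wave n) (ξ : Config n) (t : ℝ) :
    HasDerivAt (fun s : ℝ => weyl X (weyl (s • Z) f) ξ)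
      (Complex.I * weyl X (weyl (t • Z) (Omega n Z f)) ξ) t := by
  have key : ∀ η, HasDerivAt (fun s : ℝ => weyl (s • Z) f η)
      (Complex.I * weyl (t • Z) (Omega n Z f) η) t := by
    intro η
    -- The group law moves the derivative at time `0` to time `t`: pulling out `e^{iΩ(tZ)}` leaves
    -- the orbit at time `s - t`, evaluated at the translated point.
    have h0 := hasDerivAt_weyl Z f (η - (t • Z).2)
    have h1 : HasDerivAt (fun s : ℝ => weyl ((s - t) • Z) f (η - (t • Z).2))
        (Complex.I * Omega n Z f (η - (t • Z).2)) t := by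
      have h2 : HasDerivAt (fun s : ℝ => weyl (s • Z) f (η - (t • Z).2))
        (Complex.I * Omega n Z f (η - (t • Z).2)) (t - t) := by rwa [sub_self]
      exact h2.comp_sub_const t t
    have h3 : (fun s : ℝ => weyl (s • Z) f η) = fun s : ℝ =>
        Complex.exp (Complex.I * ((∑ j, (t • Z).1 j * η j
          - (1 / 2) * ∑ j, (t • Z).1 j * (t • Z).2 j : ℝ) : ℂ))
          * weyl ((s - t) • Z) f (η - (t • Z).2) := by
      funext s
      have h4 : weyl (t • Z) (weyl ((s - t) • Z) f) = weyl (s • Z) f := by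
        rw [weyl_weyl_of_symp_eq_zero (by simp [symp_self]), ← add_smul, add_sub_cancel]
      rw [← h4, weyl]
    rw [h3]
    refine (h1.const_mul _).congr_deriv ?_
    simp only [weyl]
    ring
  have h := (key (ξ - X.2)).const_mul (Complex.exp (Complex.I * ((∑ j, X.1 j * ξ j
    - (1 / 2) * ∑ j, X.1 j * X.2 j : ℝ) : ℂ)))
  refine h.congr_deriv ?_
  rw [mul_left_comm]
  rfl

theorem continuous_weyl_uncurry (f : Wave n) :
    Continuous fun p : PhaseSpace n × Config n => weyl p.1 f p.2 := by
  unfold weyl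
  have := f.continuous
  fun_prop

theorem continuous_weyl (X : PhaseSpace n) (f : Wave n) : Continuous (weyl X f) := by
  have h : Continuous fun ξ : Config n => (X, ξ) := by fun_prop
  have h' := (continuous_weyl_uncurry f).comp h
  simpa only [Function.comp_def] using h'

theorem continuous_weyl_apply (f : Wave n) (ξ : Config n) :
    Continuous fun X : PhaseSpace n => weyl X f ξ := by
  have h : Continuous fun X : PhaseSpace n => (X, ξ) := by fun_prop
  have h' := (continuous_weyl_uncurry f).comp h
  simpa only [Function.comp_def] using h'

theorem exists_norm_bound (f : Wave n) : ∃ C : ℝ, 0 ≤ C ∧ ∀ ξ, ‖f ξ‖ ≤ C :=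
  ⟨SchwartzMap.seminorm ℝ 0 0 f, apply_nonneg _ _, fun ξ => SchwartzMap.norm_le_seminorm ℝ f ξ⟩

theorem integrable_conj_mul_weyl (g f : Wave n) (X : PhaseSpace n) :
    Integrable fun ξ => conj (g ξ) * weyl X f ξ := by
  obtain ⟨C, _, hC⟩ := exists_norm_bound f
  have hg : Integrable (fun ξ => ‖g ξ‖ * C) := g.integrable.norm.mul_const C
  refine hg.mono' ?_ (.of_forall fun ξ => ?_)
  · have := continuous_weyl X f
    have := g.continuous
    exact (by fun_prop : Continuous fun ξ => conj (g ξ) * weyl X f ξ).aestronglyMeasurable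
  · rw [norm_mul, RCLike.norm_conj, norm_weyl]
    gcongr
    exact hC _

theorem waveInner_add_right (g : Wave n) (X : PhaseSpace n) (f f' : Wave n) :
    waveInner g (weyl X (f + f' : Wave n)) = waveInner g (weyl X f) + waveInner g (weyl X f') := by
  rw [waveInner, waveInner, waveInner, ← integral_add (integrable_conj_mul_weyl g f X)
    (integrable_conj_mul_weyl g f' X)]
  refine integral_congr_ae (.of_forall fun ξ => ?_)
  simp only [weyl, add_apply]
  ring

theorem waveInner_smul_right (g : Wave n) (X : PhaseSpace n) (c : ℂ) (f : Wave n) :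
    waveInner g (weyl X (c • f : Wave n)) = c * waveInner g (weyl X f) := by
  rw [waveInner, waveInner, ← integral_const_mul]
  refine integral_congr_ae (.of_forall fun ξ => ?_)
  simp only [weyl, smul_apply, smul_eq_mul]
  ring

theorem exists_norm_waveInner_le (g f : Wave n) :
    ∃ C : ℝ, ∀ X : PhaseSpace n, ‖waveInner g (weyl X f)‖ ≤ C := by
  obtain ⟨C, _, hC⟩ := exists_norm_bound f
  refine ⟨∫ ξ, ‖g ξ‖ * C, fun X => ?_⟩
  refine norm_integral_le_of_norm_le (g.integrable.norm.mul_const C) (.of_forall fun ξ => ?_)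
  rw [norm_mul, RCLike.norm_conj, norm_weyl]
  gcongr
  exact hC _

theorem continuous_waveInner_weyl (g f : Wave n) :
    Continuous fun X : PhaseSpace n => waveInner g (weyl X f) := by
  obtain ⟨C, _, hC⟩ := exists_norm_bound f
  refine continuous_of_dominated (bound := fun ξ => ‖g ξ‖ * C)
    (fun X => (integrable_conj_mul_weyl g f X).aestronglyMeasurable)
    (fun X => .of_forall fun ξ => ?_) (g.integrable.norm.mul_const C) (.of_forall fun ξ => ?_)
  · rw [norm_mul, RCLike.norm_conj, norm_weyl]
    gcongr
    exact hC _
  · exact continuous_const.mul (continuous_weyl_apply f ξ)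

theorem hasDerivAt_waveInner_weyl_weyl (g f : Wave n) (X Z : PhaseSpace n) :
    HasDerivAt (fun t : ℝ => waveInner g (weyl X (weyl (t • Z) f)))
      (Complex.I * waveInner g (weyl X (Omega n Z f))) 0 := by
  obtain ⟨C, _, hC⟩ := exists_norm_bound (Omega n Z f)
  have hcomb : ∀ (h : Wave n) (t : ℝ), Integrable fun ξ =>
      conj (g ξ) * weyl X (weyl (t • Z) h) ξ := by
    intro h t
    have := (integrable_conj_mul_weyl g h (X + t • Z)).const_mul
      (Complex.exp ((Complex.I / 2) * (symp n X (t • Z) : ℂ)))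
    refine this.congr (.of_forall fun ξ => ?_)
    simp only [weyl_weyl]
    ring
  have h := hasDerivAt_integral_of_dominated_loc_of_deriv_le (μ := volume)
    (F := fun (t : ℝ) ξ => conj (g ξ) * weyl X (weyl (t • Z) f) ξ)
    (F' := fun (t : ℝ) ξ => conj (g ξ) * (Complex.I * weyl X (weyl (t • Z) (Omega n Z f)) ξ))
    (x₀ := 0) (s := Set.univ) (bound := fun ξ => ‖g ξ‖ * C) Filter.univ_mem
    (.of_forall fun t => (hcomb f t).aestronglyMeasurable) (hcomb f 0) ?_ ?_
    (g.integrable.norm.mul_const C) ?_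
  · refine h.2.congr_deriv ?_
    simp only [zero_smul, weyl_zero, waveInner]
    rw [← integral_const_mul]
    exact integral_congr_ae (.of_forall fun ξ => by ring)
  · refine (((hcomb (Omega n Z f) 0).const_mul Complex.I).congr
      (.of_forall fun ξ => ?_)).aestronglyMeasurable
    ring
  · refine .of_forall fun ξ t _ => ?_
    rw [norm_mul, RCLike.norm_conj, norm_mul, Complex.norm_I, one_mul, norm_weyl, norm_weyl]
    gcongr
    exact hC _
  · exact .of_forall fun ξ t _ => (hasDerivAt_weyl_weyl X Z f ξ t).const_mul _

/-- By the Weyl relation, `e^{iΩ(X+tZ)}` is `e^{iΩ(X)} e^{iΩ(tZ)}` times the phase `e^{-(i/2) t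
ω(X,Z)}`; the second term is the derivative of that phase. -/
theorem hasDerivAt_waveInner_weyl_add (g f : Wave n) (X Z : PhaseSpace n) :
    HasDerivAt (fun t : ℝ => waveInner g (weyl (X + t • Z) f))
      (Complex.I * waveInner g (weyl X (Omega n Z f))
        - Complex.I / 2 * symp n X Z * waveInner g (weyl X f)) 0 := by
  have h1 := hasDerivAt_waveInner_weyl_weyl g f X Z
  have h2 : HasDerivAt (fun t : ℝ => Complex.exp (-(Complex.I / 2 * (symp n X Z : ℂ)) * (t : ℂ)))
      (-(Complex.I / 2 * (symp n X Z : ℂ))) 0 := by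
    have h := ((hasDerivAt_id (0 : ℝ)).ofReal_comp.const_mul
      (-(Complex.I / 2 * (symp n X Z : ℂ)))).cexp
    simpa using h
  have h3 := h2.mul h1
  have e : (fun t : ℝ => waveInner g (weyl (X + t • Z) f)) =
      (fun t : ℝ => Complex.exp (-(Complex.I / 2 * (symp n X Z : ℂ)) * (t : ℂ))) *
        (fun t : ℝ => waveInner g (weyl X (weyl (t • Z) f))) := by
    funext t
    simp only [waveInner, Pi.mul_apply]
    rw [← integral_const_mul]
    refine integral_congr_ae (.of_forall fun ξ => ?_)
    simp only [weyl_weyl, map_smul, smul_eq_mul, Complex.ofReal_mul]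
    rw [mul_left_comm, ← mul_assoc (Complex.exp _) (Complex.exp _), ← Complex.exp_add]
    have : -(Complex.I / 2 * (symp n X Z : ℂ)) * (t : ℂ)
      + Complex.I / 2 * ((t : ℂ) * (symp n X Z : ℂ)) = 0 := by ring
    rw [this, Complex.exp_zero, one_mul]
  rw [e]
  refine h3.congr_deriv ?_
  simp [weyl_zero]
  ring

/-- `Ω(Z)` is symmetric, and it commutes with `e^{iΩ(X)}` up to the multiple `ω(X,Z)`. -/
theorem waveInner_Omega_left (g f : Wave n) (X Z : PhaseSpace n) :
    waveInner (Omega n Z g) (weyl X f)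
      = waveInner g (weyl X (Omega n Z f)) - symp n X Z * waveInner g (weyl X f) := by
  have h1 := hasDerivAt_waveInner_weyl_add g f X Z
  -- The same function of `t`, read through the adjoint, is differentiated with `Ω(Z)` falling on
  -- `g` instead of `f`; equating the two derivatives gives the claim.
  have h2 := hasDerivAt_waveInner_weyl_add f g (-X) (-Z)
  have e : (fun t : ℝ => star (waveInner f (weyl (-X + t • -Z) g)))
      = fun t : ℝ => waveInner g (weyl (X + t • Z) f) := by
    funext t
    rw [show -X + t • -Z = -(X + t • Z) by rw [smul_neg, neg_add], ← conj_waveInner_weyl]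
    exact star_star _
  have h3 := h2.star
  rw [e] at h3
  have h4 := h1.unique h3
  have e1 : Omega n (-Z) g = -Omega n Z g := by rw [map_neg, LinearMap.neg_apply]
  have e2 : waveInner f (weyl (-X) (Omega n (-Z) g))
      = -waveInner f (weyl (-X) (Omega n Z g)) := by
    have := waveInner_smul_right f (-X) (-1) (Omega n Z g)
    rw [e1, ← neg_one_mul, ← this, neg_one_smul]
  rw [e2, ← conj_waveInner_weyl, ← conj_waveInner_weyl, ← starRingEnd_apply] at h4
  simp only [map_neg, LinearMap.neg_apply, neg_neg, map_sub, map_mul, Complex.conj_I,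
    Complex.conj_conj, map_div₀, Complex.conj_ofReal, Complex.conj_ofNat] at h4
  have h5 : Complex.I * waveInner (Omega n Z g) (weyl X f) = Complex.I *
      (waveInner g (weyl X (Omega n Z f)) - symp n X Z * waveInner g (weyl X f)) := by
    linear_combination -h4
  exact mul_left_cancel₀ Complex.I_ne_zero h5

/-! ### Rapid decay of matrix coefficients -/

theorem norm_config_le (x : Config n) : ‖x‖ ≤ ∑ j, |x j| := by
  have hx : x = ∑ j, x j • EuclideanSpace.single j (1 : ℝ) := by
    ext i
    simp [Finset.sum_apply, Pi.single_apply]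
  conv_lhs => rw [hx]
  refine (norm_sum_le _ _).trans (Finset.sum_le_sum fun j _ => ?_)
  simp [norm_smul]

theorem symp_momentum (X : PhaseSpace n) (j : Fin n) :
    symp n X (0, EuclideanSpace.single j 1) = X.1 j := by
  simp [symp]

theorem symp_position (X : PhaseSpace n) (j : Fin n) :
    symp n X (EuclideanSpace.single j 1, 0) = -X.2 j := by
  simp [symp]

/-- The coordinates of `X` are, up to sign, the values of `ω(X, ·)` on the standard basis.
Polynomial weights thus become products of `ω(X, Z)`, which commutators can absorb. -/
theorem norm_phaseSpace_le (X : PhaseSpace n) :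
    ‖X‖ ≤ ∑ j, (|symp n X (0, EuclideanSpace.single j 1)|
      + |symp n X (EuclideanSpace.single j 1, 0)|) := by
  simp only [symp_momentum, symp_position, abs_neg, Finset.sum_add_distrib]
  rw [Prod.norm_def]
  exact max_le ((norm_config_le _).trans (le_add_of_nonneg_right (by positivity)))
    ((norm_config_le _).trans (le_add_of_nonneg_left (by positivity)))

/-- Matrix coefficients of the Weyl operators between Schwartz functions decay rapidly. -/
theorem exists_pow_mul_norm_waveInner_le (k : ℕ) (g f : Wave n) :
    ∃ C : ℝ, ∀ X : PhaseSpace n, ‖X‖ ^ k * ‖waveInner g (weyl X f)‖ ≤ C := by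
  induction k generalizing g f with
  | zero => simpa using exists_norm_waveInner_le g f
  | succ k ih =>
    -- A factor `ω(X, Z)` is traded for `Ω(Z)` acting on one of the two wave functions, which stays
    -- Schwartz; this is why the induction generalizes over both.
    have step : ∀ Z : PhaseSpace n, ∃ C : ℝ, ∀ X : PhaseSpace n,
        ‖X‖ ^ k * (|symp n X Z| * ‖waveInner g (weyl X f)‖) ≤ C := by
      intro Z
      obtain ⟨C₁, h₁⟩ := ih g (Omega n Z f)
      obtain ⟨C₂, h₂⟩ := ih (Omega n Z g) f
      refine ⟨C₁ + C₂, fun X => le_trans ?_ (add_le_add (h₁ X) (h₂ X))⟩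
      rw [← mul_add]
      gcongr
      rw [← Real.norm_eq_abs, ← Complex.norm_real, ← norm_mul]
      have : (symp n X Z : ℂ) * waveInner g (weyl X f)
          = waveInner g (weyl X (Omega n Z f)) - waveInner (Omega n Z g) (weyl X f) := by
        rw [waveInner_Omega_left]; ring
      rw [this]
      exact norm_sub_le _ _
    choose C hC using step
    refine ⟨∑ j : Fin n, (C (0, EuclideanSpace.single j 1) + C (EuclideanSpace.single j 1, 0)),
      fun X => ?_⟩
    calc ‖X‖ ^ (k + 1) * ‖waveInner g (weyl X f)‖
        = ‖X‖ ^ k * (‖X‖ * ‖waveInner g (weyl X f)‖) := by ring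
      _ ≤ ‖X‖ ^ k * ((∑ j, (|symp n X (0, EuclideanSpace.single j 1)|
          + |symp n X (EuclideanSpace.single j 1, 0)|)) * ‖waveInner g (weyl X f)‖) := by
        gcongr
        exact norm_phaseSpace_le X
      _ = ∑ j, (‖X‖ ^ k * (|symp n X (0, EuclideanSpace.single j 1)| * ‖waveInner g (weyl X f)‖)
          + ‖X‖ ^ k * (|symp n X (EuclideanSpace.single j 1, 0)| * ‖waveInner g (weyl X f)‖)) := by
        rw [Finset.sum_mul, Finset.mul_sum]
        exact Finset.sum_congr rfl fun j _ => by ring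
      _ ≤ _ := Finset.sum_le_sum fun j _ => add_le_add (hC _ X) (hC _ X)

/-! ### The constrained inner product -/

section Plane

variable (L : Submodule ℝ (PhaseSpace n)) (μ : Measure L) [μ.IsAddHaarMeasure]

theorem integrable_waveInner_weyl (g f : Wave n) :
    Integrable (fun X : L => waveInner g (weyl (X : PhaseSpace n) f)) μ := by
  obtain ⟨C₁, h₁⟩ := exists_norm_waveInner_le g f
  -- `μ.integrablePower` is a decay order that suffices for integrability against `μ`; the summand
  -- `0` is the weight `k = 0` below.
  obtain ⟨C₂, h₂⟩ := exists_pow_mul_norm_waveInner_le (0 + μ.integrablePower) g f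
  have hc : Continuous fun X : L => waveInner g (weyl (X : PhaseSpace n) f) :=
    (continuous_waveInner_weyl g f).comp continuous_subtype_val
  have h := integrable_of_le_of_pow_mul_le (μ := μ) (k := 0)
    (f := fun X : L => waveInner g (weyl (X : PhaseSpace n) f))
    (fun X => h₁ X) (fun X => h₂ X) hc.aestronglyMeasurable
  simp only [pow_zero, one_mul] at h
  exact (integrable_norm_iff hc.aestronglyMeasurable).1 h

theorem physInner_add_right (g f f' : Wave n) :
    physInner L μ g (f + f') = physInner L μ g f + physInner L μ g f' := by
  simp only [physInner, waveInner_add_right]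
  exact integral_add (integrable_waveInner_weyl L μ g f) (integrable_waveInner_weyl L μ g f')

omit [μ.IsAddHaarMeasure] in
theorem physInner_smul_right (g : Wave n) (c : ℂ) (f : Wave n) :
    physInner L μ g (c • f) = c * physInner L μ g f := by
  simp only [physInner, waveInner_smul_right]
  exact integral_const_mul _ _

/-- Taking adjoints replaces `X` by `-X`, and Haar measure on `L` is invariant under negation. -/
theorem conj_physInner (g f : Wave n) : conj (physInner L μ g f) = physInner L μ f g := by
  have : μ.IsNegInvariant := Measure.IsAddHaarMeasure.isNegInvariant_of_regular μ
  rw [physInner, physInner, ← integral_conj, ← integral_neg_eq_self _ μ]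
  refine integral_congr_ae (.of_forall fun X => ?_)
  simp only [conj_waveInner_weyl, NegMemClass.coe_neg, neg_neg]

variable {L}

omit [μ.IsAddHaarMeasure] in
/-- `Ω(Z)` is symmetric for `⟨·,·⟩` when `Z` is skew-orthogonal to `L`. -/
theorem physInner_Omega_left {Z : PhaseSpace n} (hZ : Z ∈ skewOrth L) (g f : Wave n) :
    physInner L μ (Omega n Z g) f = physInner L μ g (Omega n Z f) := by
  rw [physInner, physInner]
  refine integral_congr_ae (.of_forall fun X => ?_)
  have h : symp n X Z = 0 := hZ X X.2
  simp only [waveInner_Omega_left, h]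
  simp

/-- `Ω(X)` with `X ∈ L` maps every wave function to a null vector. -/
theorem physInner_Omega_right_eq_zero (hL : IsIsotropic L) {Z : PhaseSpace n} (hZ : Z ∈ L)
    (g f : Wave n) : physInner L μ g (Omega n Z f) = 0 := by
  have hd : ∀ X : L, HasLineDerivAt ℝ (fun X : L => waveInner g (weyl (X : PhaseSpace n) f))
      (Complex.I * waveInner g (weyl (X : PhaseSpace n) (Omega n Z f))) X ⟨Z, hZ⟩ := by
    intro X
    have h := hasDerivAt_waveInner_weyl_add g f X Z
    rw [hL X X.2 Z hZ] at h
    refine HasDerivAt.congr_deriv h ?_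
    simp
  -- Integration by parts against the constant `1`: the integral of a line derivative vanishes.
  have h := integral_bilinear_hasLineDerivAt_right_eq_neg_left_of_integrable (μ := μ)
    (B := ContinuousLinearMap.mul ℝ ℂ) (f := fun _ : L => (1 : ℂ)) (f' := fun _ => 0)
    (g := fun X : L => waveInner g (weyl (X : PhaseSpace n) f))
    (g' := fun X : L => Complex.I * waveInner g (weyl (X : PhaseSpace n) (Omega n Z f)))
    (v := ⟨Z, hZ⟩) (by simp)
    (by simpa using (integrable_waveInner_weyl L μ g (Omega n Z f)).const_mul Complex.I)
    (by simpa using integrable_waveInner_weyl L μ g f)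
    (fun X _ => hasDerivAt_const _ _) (fun X _ => hd X)
  simp only [ContinuousLinearMap.mul_apply', one_mul, zero_mul, integral_zero, neg_zero,
    integral_const_mul, mul_eq_zero, Complex.I_ne_zero, false_or] at h
  exact h

end Plane

/-! ### The Gaussian test function -/

section Gaussian

theorem norm_iteratedFDeriv_exp (i : ℕ) (x : ℝ) :
    ‖iteratedFDeriv ℝ i Real.exp x‖ = Real.exp x := by
  rw [norm_iteratedFDeriv_eq_norm_iteratedDeriv, iteratedDeriv_eq_iterate, Real.iter_deriv_exp,
    Real.norm_eq_abs, Real.abs_exp]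

theorem one_add_pow_mul_exp_neg_sq_le (N : ℕ) {t : ℝ} (ht : 0 ≤ t) :
    (1 + t) ^ N * Real.exp (-t ^ 2) ≤ N.factorial * Real.exp 2 := by
  have h1 : (1 + t) ^ N ≤ N.factorial * Real.exp (1 + t) := by
    have := Real.pow_div_factorial_le_exp (1 + t) (by positivity) N
    rw [div_le_iff₀ (by positivity)] at this
    linarith
  have h2 : Real.exp (1 + t) * Real.exp (-t ^ 2) ≤ Real.exp 2 := by
    rw [← Real.exp_add, Real.exp_le_exp]
    nlinarith [sq_nonneg (t - 1)]
  calc (1 + t) ^ N * Real.exp (-t ^ 2) ≤ N.factorial * Real.exp (1 + t) * Real.exp (-t ^ 2) := by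
        gcongr
    _ ≤ N.factorial * Real.exp 2 := by rw [mul_assoc]; gcongr

/-- The Gaussian `e^{-|ξ|²}` as a real Schwartz function. -/
def gaussianSchwartz (n : ℕ) : 𝓢(Config n, ℝ) where
  toFun := Real.exp ∘ fun ξ => -‖ξ‖ ^ 2
  smooth' := Real.contDiff_exp.comp (contDiff_norm_sq ℝ).neg
  decay' := by
    intro k m
    have htemp : Function.HasTemperateGrowth fun ξ : Config n => -‖ξ‖ ^ 2 :=
      (Function.hasTemperateGrowth_norm_sq (H := Config n)).neg
    obtain ⟨l, C, hC, hgrowth⟩ := htemp.norm_iteratedFDeriv_le_uniform m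
    refine ⟨m.factorial * (C + 1) ^ m * ((k + l * m).factorial * Real.exp 2), fun ξ => ?_⟩
    -- The constant is `C + 1` so that the base is at least `1`; then it is bounded by its `i`-th
    -- power for `i ≥ 1`, as the bound for derivatives of a composition requires.
    have hbase : 1 ≤ (C + 1) * (1 + ‖ξ‖) ^ l :=
      one_le_mul_of_one_le_of_one_le (by linarith)
        (one_le_pow₀ (by linarith [norm_nonneg ξ]))
    have h := norm_iteratedFDeriv_comp_le (𝕜 := ℝ) (N := (m : ℕ∞)) Real.contDiff_exp
      ((contDiff_norm_sq ℝ (E := Config n)).neg) le_rfl ξ (n := m) (C := Real.exp (-‖ξ‖ ^ 2))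
      (D := (C + 1) * (1 + ‖ξ‖) ^ l) (fun i _ => (norm_iteratedFDeriv_exp i _).le) ?_
    · calc _ ≤ (1 + ‖ξ‖) ^ k * (m.factorial * Real.exp (-‖ξ‖ ^ 2)
            * ((C + 1) * (1 + ‖ξ‖) ^ l) ^ m) := by
            gcongr
            linarith
        _ = m.factorial * (C + 1) ^ m * ((1 + ‖ξ‖) ^ (k + l * m) * Real.exp (-‖ξ‖ ^ 2)) := by
            rw [mul_pow, ← pow_mul, pow_add]; ring
        _ ≤ _ := by
            refine mul_le_mul_of_nonneg_left ?_ (by positivity)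
            exact one_add_pow_mul_exp_neg_sq_le _ (norm_nonneg ξ)
    · intro i hi him
      refine (hgrowth i him ξ).trans (le_trans ?_ (le_self_pow₀ hbase (by lia)))
      gcongr
      linarith

/-- The Gaussian wave function `e^{-|ξ|²}`. -/
def gaussianWave (n : ℕ) : Wave n :=
  SchwartzMap.postcompCLM (𝕜 := ℝ) Complex.ofRealCLM (gaussianSchwartz n)

theorem gaussianWave_apply (ξ : Config n) : gaussianWave n ξ = Real.exp (-‖ξ‖ ^ 2) := rfl

/-- The Euclidean quadratic form on phase space that governs the overlap of the Gaussian with its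
Weyl translates. -/
def gaussForm (X : PhaseSpace n) : ℝ := ‖X.1‖ ^ 2 / 8 + ‖X.2‖ ^ 2 / 2

theorem waveInner_gaussianWave (X : PhaseSpace n) :
    waveInner (gaussianWave n) (weyl X (gaussianWave n))
      = ((Real.pi / 2 : ℝ) : ℂ) ^ (n / 2 : ℂ) * Real.exp (-gaussForm X) := by
  have h := GaussianFourier.integral_cexp_neg_mul_sq_norm_add_of_euclideanSpace (ι := Fin n)
    (b := 2) (by norm_num) Complex.I X.1
  have e : waveInner (gaussianWave n) (weyl X (gaussianWave n))
      = ∫ ξ : Config n, Complex.exp (-(‖X.2‖ ^ 2 / 2 : ℝ)) *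
        Complex.exp (-2 * ‖ξ‖ ^ 2 + Complex.I * (inner ℝ X.1 ξ : ℝ)) := by
    -- Translating by half of `Q` cancels the phase `P·Q/2` and makes the two Gaussians symmetric,
    -- so the parallelogram law separates `ξ` from `Q`.
    rw [waveInner, ← integral_add_right_eq_self _ ((1 / 2 : ℝ) • X.2)]
    refine integral_congr_ae (.of_forall fun ξ => ?_)
    have h1 : ξ + (1 / 2 : ℝ) • X.2 - X.2 = ξ - (1 / 2 : ℝ) • X.2 := by
      module
    have h2 : ∑ j, X.1 j * (ξ + (1 / 2 : ℝ) • X.2) j - (1 / 2) * ∑ j, X.1 j * X.2 j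
        = inner ℝ X.1 ξ := by
      simp only [PiLp.inner_apply, RCLike.inner_apply, conj_trivial, Finset.mul_sum,
        ← Finset.sum_sub_distrib]
      refine Finset.sum_congr rfl fun j _ => ?_
      simp only [PiLp.add_apply, PiLp.smul_apply, smul_eq_mul]
      ring
    have h3 : ‖ξ + (1 / 2 : ℝ) • X.2‖ ^ 2 + ‖ξ - (1 / 2 : ℝ) • X.2‖ ^ 2
        = 2 * ‖ξ‖ ^ 2 + ‖X.2‖ ^ 2 / 2 := by
      have := parallelogram_law_with_norm ℝ ξ ((1 / 2 : ℝ) • X.2)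
      rw [norm_smul ((1 : ℝ) / 2) X.2, Real.norm_of_nonneg (by norm_num)] at this
      linear_combination this
    simp only [weyl, h1, h2, gaussianWave_apply, Complex.conj_ofReal]
    push_cast
    rw [← Complex.exp_add, ← Complex.exp_add, ← Complex.exp_add]
    congr 1
    have h4 := congrArg (fun r : ℝ => (r : ℂ)) h3
    push_cast at h4
    linear_combination -h4
  rw [e, integral_const_mul, h, gaussForm]
  push_cast
  rw [mul_left_comm, ← Complex.exp_add, Fintype.card_fin]
  congr 2
  rw [Complex.I_sq]
  ring

end Gaussian

theorem gaussForm_smul (s : ℝ) (X : PhaseSpace n) : gaussForm (s • X) = s ^ 2 * gaussForm X := by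
  simp only [gaussForm, Prod.smul_fst, Prod.smul_snd, norm_smul, mul_pow, Real.norm_eq_abs, sq_abs]
  ring

theorem gaussForm_nonneg (X : PhaseSpace n) : 0 ≤ gaussForm X := by
  unfold gaussForm
  positivity

theorem gaussForm_add_gaussForm (X Z : PhaseSpace n) :
    gaussForm X + gaussForm (X + Z)
      = 2 * gaussForm (X + (1 / 2 : ℝ) • Z) + gaussForm Z / 2 := by
  have key : ∀ x z : Config n, ‖x‖ ^ 2 + ‖x + z‖ ^ 2
      = 2 * ‖x + (1 / 2 : ℝ) • z‖ ^ 2 + ‖z‖ ^ 2 / 2 := by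
    intro x z
    have := parallelogram_law_with_norm ℝ (x + (1 / 2 : ℝ) • z) ((1 / 2 : ℝ) • z)
    rw [show x + (1 / 2 : ℝ) • z + (1 / 2 : ℝ) • z = x + z by module, add_sub_cancel_right,
      norm_smul ((1 : ℝ) / 2) z, Real.norm_of_nonneg (by norm_num)] at this
    linear_combination this
  simp only [gaussForm, Prod.fst_add, Prod.snd_add, Prod.smul_fst, Prod.smul_snd]
  linear_combination key X.1 Z.1 / 8 + key X.2 Z.2 / 2

theorem continuous_gaussForm : Continuous (gaussForm (n := n)) := by
  unfold gaussForm
  fun_prop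

/-! ### Positivity and the null space -/

section Plane

variable (L : Submodule ℝ (PhaseSpace n)) (μ : Measure L) [μ.IsAddHaarMeasure]

theorem gaussWave_coeff_ne_zero : ((Real.pi / 2 : ℝ) : ℂ) ^ (n / 2 : ℂ) ≠ 0 := by
  rw [Complex.cpow_ne_zero_iff]
  left
  exact_mod_cast (by positivity : (Real.pi / 2 : ℝ) ≠ 0)

theorem integrable_exp_neg_gaussForm :
    Integrable (fun X : L => Real.exp (-gaussForm (X : PhaseSpace n))) μ := by
  have h := (integrable_waveInner_weyl L μ (gaussianWave n) (gaussianWave n)).const_mul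
    (((Real.pi / 2 : ℝ) : ℂ) ^ (n / 2 : ℂ))⁻¹
  simp only [waveInner_gaussianWave, inv_mul_cancel_left₀ gaussWave_coeff_ne_zero] at h
  exact h.re

theorem integrable_exp_neg_mul_gaussForm {c : ℝ} (hc : 0 < c) :
    Integrable (fun X : L => Real.exp (-(c * gaussForm (X : PhaseSpace n)))) μ := by
  have h := (integrable_exp_neg_gaussForm L μ).comp_smul (Real.sqrt_ne_zero'.2 hc)
  simpa only [Submodule.coe_smul, gaussForm_smul, Real.sq_sqrt hc.le] using h

theorem physInner_gaussianWave_ne_zero :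
    physInner L μ (gaussianWave n) (gaussianWave n) ≠ 0 := by
  simp only [physInner, waveInner_gaussianWave, integral_const_mul]
  refine mul_ne_zero gaussWave_coeff_ne_zero ?_
  rw [integral_complex_ofReal]
  exact_mod_cast (integral_exp_pos (integrable_exp_neg_gaussForm L μ)).ne'

variable {L}

/-- On an isotropic `L` the Weyl phase is trivial, so the operators `e^{iΩ(X)}` represent the
additive group of `L`. -/
theorem waveInner_weyl_sub (hL : IsIsotropic L) (X Y : L) (f g : Config n → ℂ) :
    waveInner f (weyl ((Y - X : L) : PhaseSpace n) g)
      = waveInner (weyl (X : PhaseSpace n) f) (weyl (Y : PhaseSpace n) g) := by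
  have h : symp n (-X : PhaseSpace n) Y = 0 := hL _ (neg_mem X.2) _ Y.2
  rw [waveInner_weyl_left, weyl_weyl_of_symp_eq_zero h, AddSubgroupClass.coe_sub,
    neg_add_eq_sub]

-- Justifies Fubini below: one Weyl factor is bounded in sup norm, the other has a
-- translation-invariant `L¹` norm.
omit [μ.IsAddHaarMeasure] in
theorem integrable_average {a : L → ℝ} (ha : Integrable a μ) (hac : Continuous a) (f : Wave n) :
    Integrable (fun p : (L × L) × Config n => (a p.1.1 * a p.1.2 : ℝ) *
      (conj (weyl (p.1.1 : PhaseSpace n) f p.2) * weyl (p.1.2 : PhaseSpace n) f p.2))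
      ((μ.prod μ).prod volume) := by
  obtain ⟨C, hC0, hC⟩ := exists_norm_bound f
  have hw : ∀ i : (L × L) × Config n → PhaseSpace n, Continuous i →
      Continuous fun p : (L × L) × Config n => weyl (i p) f p.2 := by
    intro i hi
    have h := (continuous_weyl_uncurry f).comp (hi.prodMk continuous_snd)
    simpa only [Function.comp_def] using h
  have h1 := hw (fun p => (p.1.1 : PhaseSpace n)) (by fun_prop)
  have h2 := hw (fun p => (p.1.2 : PhaseSpace n)) (by fun_prop)
  have hcont : Continuous (fun p : (L × L) × Config n => ((a p.1.1 * a p.1.2 : ℝ) : ℂ) *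
      (conj (weyl (p.1.1 : PhaseSpace n) f p.2) * weyl (p.1.2 : PhaseSpace n) f p.2)) := by
    fun_prop
  have hb : ∀ p : L × L, Integrable fun ξ : Config n =>
      ‖a p.1 * a p.2‖ * (‖f (ξ - (p.1 : PhaseSpace n).2)‖ * C) := fun p =>
    ((f.integrable.norm.comp_sub_right _).mul_const C).const_mul _
  have hle : ∀ (p : L × L) (ξ : Config n), ‖((a p.1 * a p.2 : ℝ) : ℂ) *
      (conj (weyl (p.1 : PhaseSpace n) f ξ) * weyl (p.2 : PhaseSpace n) f ξ)‖
      ≤ ‖a p.1 * a p.2‖ * (‖f (ξ - (p.1 : PhaseSpace n).2)‖ * C) := by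
    intro p ξ
    rw [norm_mul, norm_mul, RCLike.norm_conj, norm_weyl, norm_weyl, Complex.norm_real]
    gcongr
    exact hC _
  have hslice : ∀ p : L × L, Continuous fun ξ : Config n => ((a p.1 * a p.2 : ℝ) : ℂ) *
      (conj (weyl (p.1 : PhaseSpace n) f ξ) * weyl (p.2 : PhaseSpace n) f ξ) := fun p => by
    have h := hcont.comp (Continuous.prodMk_right p)
    simpa only [Function.comp_def] using h
  rw [integrable_prod_iff hcont.aestronglyMeasurable]
  refine ⟨.of_forall fun p => (hb p).mono' (hslice p).aestronglyMeasurable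
    (.of_forall (hle p)), ?_⟩
  refine ((ha.mul_prod ha).norm.mul_const ((∫ ξ, ‖f ξ‖) * C)).mono'
    hcont.norm.stronglyMeasurable.integral_prod_right.aestronglyMeasurable
    (.of_forall fun p => ?_)
  rw [Real.norm_of_nonneg (by positivity)]
  refine (integral_mono_of_nonneg (.of_forall fun ξ => norm_nonneg _) (hb p)
    (.of_forall (hle p))).trans (le_of_eq ?_)
  rw [integral_const_mul, integral_mul_const,
    integral_sub_right_eq_self (fun ξ => ‖f ξ‖) (p.1 : PhaseSpace n).2]

/-- The double integral is the squared `L²` norm of the averaged function `∫ a(X) e^{iΩ(X)} f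
dμ(X)`. -/
theorem re_integral_average_nonneg (hL : IsIsotropic L) {a : L → ℝ} (ha : Integrable a μ)
    (hac : Continuous a) (f : Wave n) :
    0 ≤ (∫ p : L × L, ((a p.1 * a p.2 : ℝ) : ℂ) *
      waveInner f (weyl ((p.2 - p.1 : L) : PhaseSpace n) f) ∂(μ.prod μ)).re := by
  have h1 : ∫ p : L × L, ((a p.1 * a p.2 : ℝ) : ℂ) *
      waveInner f (weyl ((p.2 - p.1 : L) : PhaseSpace n) f) ∂(μ.prod μ)
      = ∫ ξ : Config n, conj (∫ X : L, a X * weyl (X : PhaseSpace n) f ξ ∂μ)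
        * ∫ X : L, a X * weyl (X : PhaseSpace n) f ξ ∂μ := by
    simp only [waveInner_weyl_sub hL]
    conv_lhs => simp only [waveInner, ← integral_const_mul]
    rw [integral_integral_swap (integrable_average μ ha hac f)]
    refine integral_congr_ae (.of_forall fun ξ => ?_)
    simp only
    rw [← integral_conj, ← integral_prod_mul (μ := μ) (ν := μ)
      (fun X : L => conj (a X * weyl (X : PhaseSpace n) f ξ))
      (fun X : L => a X * weyl (X : PhaseSpace n) f ξ)]
    refine integral_congr_ae (.of_forall fun p => ?_)
    simp only [map_mul, Complex.conj_ofReal, Complex.ofReal_mul]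
    ring
  rw [h1]
  have h2 : ∀ z : ℂ, conj z * z = ((‖z‖ ^ 2 : ℝ) : ℂ) := fun z => by
    rw [Complex.conj_mul']; norm_cast
  simp only [h2]
  rw [integral_complex_ofReal, Complex.ofReal_re]
  exact integral_nonneg fun ξ => by positivity

theorem re_integral_exp_mul_nonneg (hL : IsIsotropic L) {s : ℝ} (hs : 0 < s) (f : Wave n) :
    0 ≤ (∫ Z : L, (Real.exp (-(s * gaussForm (Z : PhaseSpace n))) : ℂ) *
      waveInner f (weyl (Z : PhaseSpace n) f) ∂μ).re := by
  -- After the substitution `Z = Y - X`, `gaussForm_add_gaussForm` splits the exponent. The weight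
  -- `2s` leaves `s` on `Z` and `4s` on the shifted `X`, whose integral is a positive constant.
  set a : L → ℝ := fun X => Real.exp (-(2 * s * gaussForm (X : PhaseSpace n))) with ha
  have hai : Integrable a μ := integrable_exp_neg_mul_gaussForm L μ (by positivity)
  have hac : Continuous a := by
    have := continuous_gaussForm (n := n)
    fun_prop
  set F : L → ℂ := fun Z => waveInner f (weyl (Z : PhaseSpace n) f) with hF
  have hint : Integrable (fun p : L × L => ((a p.1 * a p.2 : ℝ) : ℂ) * F (p.2 - p.1))
      (μ.prod μ) := by
    refine (integrable_average μ hai hac f).integral_prod_left.congr (.of_forall fun p => ?_)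
    simp only [hF, waveInner_weyl_sub hL]
    simp only [waveInner, ← integral_const_mul]
  have hmp := measurePreserving_prod_add μ μ
  have hme : MeasurableEmbedding fun z : L × L => (z.1, z.1 + z.2) :=
    (MeasurableEquiv.shearAddRight L).measurableEmbedding
  have hint2 := (hmp.integrable_comp_emb hme).2 hint
  have h0 := re_integral_average_nonneg μ hL hai hac f
  rw [← hmp.integral_comp hme] at h0
  simp only [Function.comp_def, add_sub_cancel_left] at h0 hint2
  rw [integral_prod_symm _ hint2] at h0
  have hin : ∀ Z : L, ∫ X : L, ((a X * a (X + Z) : ℝ) : ℂ) * F Z ∂μ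
      = (∫ X : L, Real.exp (-(4 * s * gaussForm (X : PhaseSpace n))) ∂μ : ℝ) *
        ((Real.exp (-(s * gaussForm (Z : PhaseSpace n))) : ℂ) * F Z) := by
    intro Z
    rw [integral_mul_const, ← mul_assoc]
    congr 1
    rw [integral_complex_ofReal, ← Complex.ofReal_mul, ← integral_mul_const,
      ← integral_add_right_eq_self (fun X : L =>
        Real.exp (-(4 * s * gaussForm (X : PhaseSpace n)))
          * Real.exp (-(s * gaussForm (Z : PhaseSpace n)))) ((1 / 2 : ℝ) • Z)]
    congr 1
    refine integral_congr_ae (.of_forall fun X => ?_)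
    simp only [ha, ← Real.exp_add, Submodule.coe_add, Submodule.coe_smul]
    congr 1
    linear_combination -(2 * s) * gaussForm_add_gaussForm (X : PhaseSpace n) Z
  simp only [hin] at h0
  rw [integral_const_mul, Complex.re_ofReal_mul] at h0
  exact nonneg_of_mul_nonneg_right h0
    (integral_exp_pos (integrable_exp_neg_mul_gaussForm L μ (by positivity)))

/-- The constrained inner product is positive semidefinite. -/
theorem re_physInner_self_nonneg (hL : IsIsotropic L) (f : Wave n) :
    0 ≤ (physInner L μ f f).re := by
  -- The Gaussian cutoff with `s = 1/(k+1)` is removed by dominated convergence.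
  have hlim : Tendsto (fun k : ℕ => ∫ Z : L,
      (Real.exp (-((1 / ((k : ℝ) + 1)) * gaussForm (Z : PhaseSpace n))) : ℂ) *
        waveInner f (weyl (Z : PhaseSpace n) f) ∂μ) atTop (𝓝 (physInner L μ f f)) := by
    have hF := integrable_waveInner_weyl L μ f f
    refine tendsto_integral_of_dominated_convergence _ (fun k => ?_) hF.norm (fun k => ?_) ?_
    · have := continuous_gaussForm (n := n)
      have hc : Continuous fun Z : L =>
        (Real.exp (-((1 / ((k : ℝ) + 1)) * gaussForm (Z : PhaseSpace n))) : ℂ) := by fun_prop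
      exact hc.aestronglyMeasurable.mul hF.aestronglyMeasurable
    · refine .of_forall fun Z => ?_
      rw [norm_mul, Complex.norm_real, Real.norm_eq_abs, Real.abs_exp]
      refine mul_le_of_le_one_left (norm_nonneg _) (Real.exp_le_one_iff.2 ?_)
      have := gaussForm_nonneg (Z : PhaseSpace n)
      rw [neg_nonpos]
      positivity
    · refine .of_forall fun Z => ?_
      have h1 : Tendsto (fun k : ℕ =>
          Real.exp (-((1 / ((k : ℝ) + 1)) * gaussForm (Z : PhaseSpace n)))) atTop (𝓝 1) := by
        have := ((tendsto_one_div_add_atTop_nhds_zero_nat (𝕜 := ℝ)).mul_const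
          (gaussForm (Z : PhaseSpace n))).neg.rexp
        simpa using this
      have h2 := ((Complex.continuous_ofReal.tendsto 1).comp h1).mul_const
        (waveInner f (weyl (Z : PhaseSpace n) f))
      simpa [Function.comp_def] using h2
  exact ge_of_tendsto' ((Complex.continuous_re.tendsto _).comp hlim)
    fun k => re_integral_exp_mul_nonneg μ hL (by positivity) f

/-- A null vector is orthogonal to every wave function. -/
theorem physInner_eq_zero_of_self (hL : IsIsotropic L) {f : Wave n} (hf : physInner L μ f f = 0)
    (g : Wave n) : physInner L μ g f = 0 := by
  let core : PreInnerProductSpace.Core ℂ (Wave n) :=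
    { inner := physInner L μ
      conj_inner_symm := fun x y => conj_physInner L μ y x
      re_inner_nonneg := re_physInner_self_nonneg μ hL
      add_left := fun x y z => by
        rw [← conj_physInner L μ z, physInner_add_right, map_add, conj_physInner, conj_physInner]
      smul_left := fun x y r => by
        rw [← conj_physInner L μ y, physInner_smul_right, map_mul, conj_physInner] }
  have h := InnerProductSpace.Core.inner_mul_inner_self_le (c := core) g f
  change ‖physInner L μ g f‖ * ‖physInner L μ f g‖
    ≤ (physInner L μ g g).re * (physInner L μ f f).re at h
  rw [hf, Complex.zero_re, mul_zero, ← conj_physInner L μ g f, RCLike.norm_conj] at h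
  exact norm_eq_zero.1 (mul_self_eq_zero.1 (le_antisymm h (mul_self_nonneg _)))

/-- The null space of the constrained inner product. -/
def nullSpace (L : Submodule ℝ (PhaseSpace n)) (μ : Measure L) [μ.IsAddHaarMeasure] :
    Submodule ℂ (Wave n) where
  carrier := {f | ∀ g, physInner L μ g f = 0}
  add_mem' := fun hf hf' g => by rw [physInner_add_right, hf g, hf' g, add_zero]
  zero_mem' := fun g => by
    have := physInner_smul_right L μ g 0 0
    rwa [zero_smul, zero_mul] at this
  smul_mem' := fun c f hf g => by rw [physInner_smul_right, hf g, mul_zero]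

/-- This makes the quadratic condition linear: equivalence becomes congruence modulo a subspace. -/
theorem gaugeEquiv_iff (hL : IsIsotropic L) (f₁ f₂ : Wave n) :
    GaugeEquiv L μ f₁ f₂ ↔ f₁ - f₂ ∈ nullSpace L μ :=
  ⟨fun h => physInner_eq_zero_of_self μ hL h, fun h => h _⟩

theorem preservesEquiv_iff (hL : IsIsotropic L) (H : Module.End ℂ (Wave n)) :
    PreservesEquiv L μ H ↔ ∀ f ∈ nullSpace L μ, H f ∈ nullSpace L μ := by
  simp only [PreservesEquiv, gaugeEquiv_iff μ hL, ← map_sub]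
  exact ⟨fun h f hf => by simpa using h f 0 (by simpa using hf), fun h f₁ f₂ => h _⟩

theorem Omega_mem_nullSpace (hL : IsIsotropic L) {X : PhaseSpace n} (hX : X ∈ L) (f : Wave n) :
    Omega n X f ∈ nullSpace L μ :=
  fun g => physInner_Omega_right_eq_zero μ hL hX g f

theorem Omega_mem_nullSpace_of_mem {Z : PhaseSpace n} (hZ : Z ∈ skewOrth L) {f : Wave n}
    (hf : f ∈ nullSpace L μ) : Omega n Z f ∈ nullSpace L μ := fun g => by
  rw [← physInner_Omega_left μ hZ]
  exact hf _

theorem gaussianWave_notMem_nullSpace : gaussianWave n ∉ nullSpace L μ :=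
  fun h => physInner_gaussianWave_ne_zero L μ (h _)

end Plane

/-! ### Commutation relations -/

theorem eq_zero_of_waveInner_eq_zero {f : Wave n} (h : waveInner f f = 0) : f = 0 := by
  have h1 : waveInner f f = ((∫ ξ, ‖f ξ‖ ^ 2 : ℝ) : ℂ) := by
    rw [waveInner, ← integral_complex_ofReal]
    refine integral_congr_ae (.of_forall fun ξ => ?_)
    simp only
    rw [Complex.conj_mul']
    norm_cast
  have hint : Integrable fun ξ => ‖f ξ‖ ^ 2 := by
    have h := (integrable_conj_mul_weyl f f 0).norm
    simp only [weyl_zero, norm_mul, RCLike.norm_conj, ← sq] at h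
    exact h
  rw [h1, Complex.ofReal_eq_zero, integral_eq_zero_iff_of_nonneg (fun ξ => by positivity) hint] at h
  have hc : Continuous fun ξ => ‖f ξ‖ ^ 2 := by
    have := f.continuous
    fun_prop
  have h2 := (Continuous.ae_eq_iff_eq volume hc continuous_zero).1 h
  ext ξ
  simpa using congrFun h2 ξ

/-- The canonical commutation relation `[Ω(X), Ω(Y)] = -i ω(X,Y)`. -/
theorem Omega_Omega (X Y : PhaseSpace n) (f : Wave n) :
    Omega n X (Omega n Y f) = Omega n Y (Omega n X f) - (Complex.I * symp n X Y) • f := by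
  have key : ∀ g : Wave n, waveInner g (Omega n X (Omega n Y f))
      = waveInner g (Omega n Y (Omega n X f)) - Complex.I * symp n X Y * waveInner g f := by
    intro g
    -- The identity `waveInner_Omega_left` is differentiated along `tX` at `t = 0`. Its correction
    -- term is `t ω(X,Y)` times a coefficient, so the product rule yields the central term.
    have h1 := hasDerivAt_waveInner_weyl_add (Omega n Y g) f 0 X
    have h2 := hasDerivAt_waveInner_weyl_add g (Omega n Y f) 0 X
    have h3 := hasDerivAt_waveInner_weyl_add g f 0 X
    have h4 : HasDerivAt (fun t : ℝ => (t : ℂ) * symp n X Y) (symp n X Y) 0 := by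
      simpa using (hasDerivAt_id (0 : ℝ)).ofReal_comp.mul_const (symp n X Y : ℂ)
    have h5 := h2.sub (h4.mul h3)
    have e : (fun t : ℝ => waveInner (Omega n Y g) (weyl (0 + t • X) f))
        = (fun t : ℝ => waveInner g (weyl (0 + t • X) (Omega n Y f)))
          - (fun t : ℝ => (t : ℂ) * symp n X Y) * fun t : ℝ => waveInner g (weyl (0 + t • X) f) := by
      funext t
      simp [waveInner_Omega_left]
    rw [e] at h1
    have h6 := h1.unique h5
    simp only [zero_smul, weyl_zero, map_zero, LinearMap.zero_apply, Complex.ofReal_zero,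
      mul_zero, zero_mul, sub_zero, add_zero] at h6
    have h7 := waveInner_Omega_left g (Omega n X f) 0 Y
    simp only [weyl_zero, map_zero, LinearMap.zero_apply, Complex.ofReal_zero, zero_mul,
      sub_zero] at h7
    rw [h7] at h6
    linear_combination Complex.I * h6 - (waveInner g (Omega n Y (Omega n X f))
      - waveInner g (Omega n X (Omega n Y f))) * Complex.I_sq
  set d : Wave n := Omega n X (Omega n Y f) + (-1 : ℂ) • Omega n Y (Omega n X f)
    + (Complex.I * symp n X Y) • f with hd
  have hd0 : ∀ g : Wave n, waveInner g d = 0 := by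
    intro g
    have h1 := waveInner_add_right g 0 (Omega n X (Omega n Y f)
      + (-1 : ℂ) • Omega n Y (Omega n X f)) ((Complex.I * symp n X Y) • f)
    have h2 := waveInner_add_right g 0 (Omega n X (Omega n Y f))
      ((-1 : ℂ) • Omega n Y (Omega n X f))
    simp only [weyl_zero] at h1 h2
    rw [hd, h1, h2, key]
    have h3 := waveInner_smul_right g 0 (-1) (Omega n Y (Omega n X f))
    have h4 := waveInner_smul_right g 0 (Complex.I * symp n X Y) f
    simp only [weyl_zero] at h3 h4
    rw [h3, h4]
    ring
  have h0 := eq_zero_of_waveInner_eq_zero (hd0 d)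
  rw [hd] at h0
  rw [← sub_eq_zero, ← h0]
  module

theorem Omega_real_smul (r : ℝ) (X : PhaseSpace n) (f : Wave n) :
    Omega n (r • X) f = (r : ℂ) • Omega n X f := by
  rw [map_smul, LinearMap.smul_apply, Complex.coe_smul]

theorem Omega₂_real_smul (r : ℝ) (Γ : PhaseSpace n ⊗[ℝ] PhaseSpace n) (f : Wave n) :
    Omega₂ n (r • Γ) f = (r : ℂ) • Omega₂ n Γ f := by
  rw [map_smul, LinearMap.smul_apply, Complex.coe_smul]

theorem Omega₂_add (Γ Γ' : PhaseSpace n ⊗[ℝ] PhaseSpace n) (f : Wave n) :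
    Omega₂ n (Γ + Γ') f = Omega₂ n Γ f + Omega₂ n Γ' f := by
  rw [map_add, LinearMap.add_apply]

theorem Omega₂_symm (x y : PhaseSpace n) (f : Wave n) :
    Omega₂ n (x ⊗ₜ y + y ⊗ₜ x) f = Omega n x (Omega n y f) + Omega n y (Omega n x f) := by
  rw [Omega₂_add]
  simp [Omega₂]

/-- Contraction of the second tensor factor with `ω(·, X)`. -/
def contract (X : PhaseSpace n) : PhaseSpace n ⊗[ℝ] PhaseSpace n →ₗ[ℝ] PhaseSpace n :=
  (TensorProduct.rid ℝ (PhaseSpace n)).toLinearMap ∘ₗ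
    LinearMap.lTensor (PhaseSpace n) ((symp n).flip X)

theorem contract_tmul (X x y : PhaseSpace n) : contract X (x ⊗ₜ y) = symp n y X • x := by
  simp [contract]

/-- The commutator of a quadratic observable with a linear one is linear. -/
theorem Omega₂_Omega {Γ : PhaseSpace n ⊗[ℝ] PhaseSpace n} (hΓ : Γ ∈ symTensor (n := n) ⊤ ⊤)
    (X : PhaseSpace n) (f : Wave n) :
    Omega₂ n Γ (Omega n X f)
      = Omega n X (Omega₂ n Γ f) - (2 * Complex.I) • Omega n (contract X Γ) f := by
  induction hΓ using Submodule.span_induction with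
  | mem t ht =>
    obtain ⟨x, -, y, -, rfl⟩ := ht
    rw [Omega₂_symm, Omega₂_symm, Omega_Omega y X f, Omega_Omega x X f, map_sub, map_sub,
      map_smul, map_smul, Omega_Omega x X, Omega_Omega y X, map_add, map_add, contract_tmul,
      contract_tmul, map_add, LinearMap.add_apply, Omega_real_smul, Omega_real_smul]
    module
  | zero => simp
  | add s t _ _ hs ht =>
    rw [Omega₂_add, Omega₂_add, hs, ht, map_add, map_add, map_add, LinearMap.add_apply]
    module
  | smul c t _ ht =>
    rw [Omega₂_real_smul, Omega₂_real_smul, ht, map_smul (contract X), Omega_real_smul, map_smul]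
    module

/-! ### Symplectic linear algebra of symmetric tensors -/

theorem symp_nondegenerate : (symp n).Nondegenerate := by
  have h : ∀ X, (∀ Y, symp n X Y = 0) → X = 0 := fun X hX => by
    have h1 := norm_phaseSpace_le X
    simp only [hX, abs_zero, add_zero, Finset.sum_const_zero] at h1
    exact norm_le_zero_iff.1 h1
  exact ⟨h, fun X hX => h X fun Y => by rw [symp_swap, hX, neg_zero]⟩

theorem symp_isRefl : (symp n).IsRefl := fun X Y h => by rw [symp_swap, h, neg_zero]

theorem skewOrth_skewOrth (L : Submodule ℝ (PhaseSpace n)) : skewOrth (skewOrth L) = L :=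
  LinearMap.BilinForm.orthogonal_orthogonal symp_nondegenerate symp_isRefl L

/-- A functional that vanishes on the skew-orthogonal complement of `L` is `ω(·, X)` with
`X ∈ L`. -/
theorem exists_symp_eq {L : Submodule ℝ (PhaseSpace n)} (φ : PhaseSpace n →ₗ[ℝ] ℝ)
    (hφ : ∀ Y ∈ skewOrth L, φ Y = 0) : ∃ X ∈ L, ∀ v, φ v = symp n v X := by
  set X := ((symp n).toDual symp_nondegenerate).symm φ with hX
  have h : ∀ v, symp n X v = φ v := fun v =>
    LinearMap.BilinForm.apply_toDual_symm_apply (hB := symp_nondegenerate) φ v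
  refine ⟨-X, neg_mem ?_, fun v => ?_⟩
  · rw [← skewOrth_skewOrth L]
    intro Y hY
    rw [symp_swap, h, hφ Y hY, neg_zero]
  · rw [map_neg, symp_swap, h, neg_neg]

theorem exists_projection (L : Submodule ℝ (PhaseSpace n)) :
    ∃ p : PhaseSpace n →ₗ[ℝ] PhaseSpace n, (∀ x, p x ∈ L) ∧ ∀ x ∈ L, p x = x := by
  obtain ⟨r, hr⟩ := LinearMap.exists_leftInverse_of_injective L.subtype L.ker_subtype
  exact ⟨L.subtype ∘ₗ r, fun x => (r x).2, fun x hx =>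
    congrArg Subtype.val (LinearMap.congr_fun hr ⟨x, hx⟩)⟩

/-- Each coordinate of `c` vanishes on `skewOrth L`, hence is `ω(·, Xᵢ)` with `Xᵢ ∈ L`. The image of
`Γ` is then a sum of terms `d (contract Xᵢ Γ) ⊗ bᵢ`, and `d` kills `L`. -/
theorem map_eq_zero_of_contract_mem {L : Submodule ℝ (PhaseSpace n)}
    {Γ : PhaseSpace n ⊗[ℝ] PhaseSpace n} (hΓ : ∀ X ∈ L, contract X Γ ∈ L)
    (d c : PhaseSpace n →ₗ[ℝ] PhaseSpace n) (hd : ∀ x ∈ L, d x = 0)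
    (hc : ∀ x ∈ skewOrth L, c x = 0) : TensorProduct.map d c Γ = 0 := by
  let b := Module.finBasis ℝ (PhaseSpace n)
  have h : ∀ i, ∃ X ∈ L, ∀ v, b.repr (c v) i = symp n v X := fun i =>
    exists_symp_eq ((b.coord i) ∘ₗ c) fun Y hY => by simp [hc Y hY]
  choose X hXL hX using h
  have key : ∀ T : PhaseSpace n ⊗[ℝ] PhaseSpace n,
      TensorProduct.map d c T = ∑ i, d (contract (X i) T) ⊗ₜ[ℝ] b i := by
    intro T
    induction T using TensorProduct.induction_on with
    | zero => simp
    | tmul x y =>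
      rw [TensorProduct.map_tmul, ← b.sum_repr (c y), TensorProduct.tmul_sum]
      refine Finset.sum_congr rfl fun i _ => ?_
      rw [hX, contract_tmul, map_smul, TensorProduct.tmul_smul,
        TensorProduct.smul_tmul']
    | add s t hs ht =>
      rw [map_add, hs, ht, ← Finset.sum_add_distrib]
      simp only [map_add, TensorProduct.add_tmul]
  rw [key]
  refine Finset.sum_eq_zero fun i _ => ?_
  rw [hd _ (hΓ _ (hXL i)), TensorProduct.zero_tmul]

theorem le_skewOrth {L : Submodule ℝ (PhaseSpace n)} (hL : IsIsotropic L) : L ≤ skewOrth L :=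
  fun X hX Y hY => hL Y hY X hX

theorem map_mem_symTensor {A B : Submodule ℝ (PhaseSpace n)}
    (f g : PhaseSpace n →ₗ[ℝ] PhaseSpace n) (hf : ∀ x, f x ∈ A) (hg : ∀ x, g x ∈ B)
    {Γ : PhaseSpace n ⊗[ℝ] PhaseSpace n} (hΓ : Γ ∈ symTensor (n := n) ⊤ ⊤) :
    TensorProduct.map f g Γ + TensorProduct.map g f Γ ∈ symTensor A B := by
  induction hΓ using Submodule.span_induction with
  | mem t ht =>
    obtain ⟨x, -, y, -, rfl⟩ := ht
    have h1 : f x ⊗ₜ[ℝ] g y + g y ⊗ₜ f x ∈ symTensor A B :=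
      Submodule.subset_span ⟨_, hf x, _, hg y, rfl⟩
    have h2 : f y ⊗ₜ[ℝ] g x + g x ⊗ₜ f y ∈ symTensor A B :=
      Submodule.subset_span ⟨_, hf y, _, hg x, rfl⟩
    convert! add_mem h1 h2 using 1
    simp only [map_add, TensorProduct.map_tmul]
    abel
  | zero => simp
  | add s t _ _ hs ht =>
    convert! add_mem hs ht using 1
    simp only [map_add]
    abel
  | smul c t _ ht =>
    convert! Submodule.smul_mem _ c ht using 1
    simp only [map_smul, smul_add]

/-- A symmetric tensor whose contractions with `L` lie in `L` splits into a part on the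
skew-orthogonal complement and a part that involves `L`. -/
theorem mem_sup_of_contract_mem {L : Submodule ℝ (PhaseSpace n)} (hL : IsIsotropic L)
    {Γ : PhaseSpace n ⊗[ℝ] PhaseSpace n} (hΓ : Γ ∈ symTensor (n := n) ⊤ ⊤)
    (hc : ∀ X ∈ L, contract X Γ ∈ L) :
    Γ ∈ symTensor (skewOrth L) (skewOrth L) ⊔ symTensor L ⊤ := by
  obtain ⟨p, hp, hp'⟩ := exists_projection (skewOrth L)
  obtain ⟨q, hq, hq'⟩ := exists_projection L
  set c : PhaseSpace n →ₗ[ℝ] PhaseSpace n := LinearMap.id - p with hcdef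
  have hc0 : ∀ x ∈ skewOrth L, c x = 0 := fun x hx => by simp [c, hp' x hx]
  have h1 : TensorProduct.map (p - q) c Γ = 0 :=
    map_eq_zero_of_contract_mem hc _ _
      (fun x hx => by simp [hq' x hx, hp' x (le_skewOrth hL hx)]) hc0
  have h2' : TensorProduct.map (LinearMap.id - q) c Γ = 0 :=
    map_eq_zero_of_contract_mem hc _ _ (fun x hx => by simp [hq' x hx]) hc0
  have hcomm : ∀ (f g : PhaseSpace n →ₗ[ℝ] PhaseSpace n) (T : PhaseSpace n ⊗[ℝ] PhaseSpace n),
      TensorProduct.map f g (TensorProduct.comm ℝ _ _ T)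
        = TensorProduct.comm ℝ _ _ (TensorProduct.map g f T) := by
    intro f g T
    induction T using TensorProduct.induction_on with
    | zero => simp
    | tmul x y => simp
    | add s t hs ht => simp only [map_add, hs, ht]
  have h2 : TensorProduct.map c (LinearMap.id - q) Γ = 0 := by
    rw [← (mem_symTensor_top Γ).1 hΓ, hcomm, h2', map_zero]
  -- With `id = p + c`, expand `id ⊗ id`; `p ⊗ c` is split through `q`, and so is `c ⊗ p + c ⊗ c = c
  -- ⊗ id`. The last bracket vanishes on `Γ`, its second term by the symmetry of `Γ`.
  have hsplit : ∀ T : PhaseSpace n ⊗[ℝ] PhaseSpace n,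
      T = TensorProduct.map p p T + (TensorProduct.map q c T + TensorProduct.map c q T)
        + (TensorProduct.map (p - q) c T + TensorProduct.map c (LinearMap.id - q) T) := by
    intro T
    induction T using TensorProduct.induction_on with
    | zero => simp
    | tmul x y =>
      simp only [hcdef, TensorProduct.map_tmul, LinearMap.sub_apply, LinearMap.id_apply,
        TensorProduct.sub_tmul, TensorProduct.tmul_sub]
      abel
    | add s t hs ht =>
      simp only [map_add]
      nth_rewrite 1 [hs, ht]
      abel
  rw [hsplit Γ, h1, h2, add_zero, add_zero]
  refine add_mem (Submodule.mem_sup_left ?_) (Submodule.mem_sup_right ?_)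
  · have h := Submodule.smul_mem _ (1 / 2 : ℝ) (map_mem_symTensor p p hp hp hΓ)
    rw [← two_smul ℝ (TensorProduct.map p p Γ), smul_smul] at h
    simpa using h
  · exact map_mem_symTensor q c hq (fun _ => Submodule.mem_top) hΓ

/-! ### Quadratic observables on the null space -/

section Plane

variable {L : Submodule ℝ (PhaseSpace n)} (μ : Measure L) [μ.IsAddHaarMeasure]

theorem Omega₂_mem_nullSpace {Γ : PhaseSpace n ⊗[ℝ] PhaseSpace n}
    (hΓ : Γ ∈ symTensor (skewOrth L) (skewOrth L)) {f : Wave n} (hf : f ∈ nullSpace L μ) :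
    Omega₂ n Γ f ∈ nullSpace L μ := by
  induction hΓ using Submodule.span_induction with
  | mem t ht =>
    obtain ⟨x, hx, y, hy, rfl⟩ := ht
    rw [Omega₂_symm]
    exact add_mem (Omega_mem_nullSpace_of_mem μ hx (Omega_mem_nullSpace_of_mem μ hy hf))
      (Omega_mem_nullSpace_of_mem μ hy (Omega_mem_nullSpace_of_mem μ hx hf))
  | zero => simp
  | add s t _ _ hs ht => rw [Omega₂_add]; exact add_mem hs ht
  | smul c t _ ht => rw [Omega₂_real_smul]; exact Submodule.smul_mem _ _ ht

/-- Modulo null vectors, a symmetric tensor with one factor in `L` acts as an imaginary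
constant. -/
theorem exists_Omega₂_sub_mem_nullSpace (hL : IsIsotropic L)
    {Γ : PhaseSpace n ⊗[ℝ] PhaseSpace n} (hΓ : Γ ∈ symTensor L ⊤) :
    ∃ r : ℝ, ∀ f : Wave n, Omega₂ n Γ f - (Complex.I * r) • f ∈ nullSpace L μ := by
  induction hΓ using Submodule.span_induction with
  | mem t ht =>
    obtain ⟨x, hx, y, -, rfl⟩ := ht
    -- The symmetrized product equals `2 Ω(x) Ω(y) - i ω(y,x)`, and `Ω(x)` has null range since `x ∈
    -- L`.
    refine ⟨-symp n y x, fun f => ?_⟩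
    rw [Omega₂_symm, Omega_Omega y x]
    have h := Submodule.smul_mem _ (2 : ℂ) (Omega_mem_nullSpace μ hL hx (Omega n y f))
    convert! h using 1
    push_cast
    module
  | zero => exact ⟨0, fun f => by simp⟩
  | add s t _ _ hs ht =>
    obtain ⟨r, hr⟩ := hs
    obtain ⟨r', hr'⟩ := ht
    refine ⟨r + r', fun f => ?_⟩
    rw [Omega₂_add]
    convert! add_mem (hr f) (hr' f) using 1
    push_cast
    module
  | smul c t _ ht =>
    obtain ⟨r, hr⟩ := ht
    refine ⟨c * r, fun f => ?_⟩
    rw [Omega₂_real_smul]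
    convert! Submodule.smul_mem _ (c : ℂ) (hr f) using 1
    push_cast
    module

/-- If `ω(Y, Z) ≠ 0` for some `Y ∈ skewOrth L`, the commutator of `Ω(Y)` and `Ω(Z)` is a nonzero
scalar with null range, although the Gaussian is not null. Biduality then gives membership in `L`.
-/
theorem mem_of_Omega_mem_nullSpace {Z : PhaseSpace n}
    (hZ : ∀ f : Wave n, Omega n Z f ∈ nullSpace L μ) : Z ∈ L := by
  rw [← skewOrth_skewOrth L]
  intro Y hY
  by_contra hne
  have h := sub_mem (Omega_mem_nullSpace_of_mem μ hY (hZ (gaussianWave n)))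
    (hZ (Omega n Y (gaussianWave n)))
  rw [Omega_Omega Y Z, sub_sub_cancel_left, neg_mem_iff] at h
  refine gaussianWave_notMem_nullSpace μ ((Submodule.smul_mem_iff _ ?_).1 h)
  exact mul_ne_zero Complex.I_ne_zero (by exact_mod_cast hne)

theorem quadHam_apply (Γ : PhaseSpace n ⊗[ℝ] PhaseSpace n) (ε : ℝ) (f : Wave n) :
    quadHam Γ ε f = Omega₂ n Γ f + (ε : ℂ) • f := rfl

theorem mem_sup_of_preservesEquiv (hL : IsIsotropic L)
    {Γ : PhaseSpace n ⊗[ℝ] PhaseSpace n} (hΓ : Γ ∈ symTensor (n := n) ⊤ ⊤) (ε : ℝ)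
    (h : PreservesEquiv L μ (quadHam Γ ε)) :
    Γ ∈ symTensor (skewOrth L) (skewOrth L) ⊔ symTensor L ⊤ := by
  rw [preservesEquiv_iff μ hL] at h
  refine mem_sup_of_contract_mem hL hΓ fun X hX => mem_of_Omega_mem_nullSpace μ fun f => ?_
  -- Both orders of the product are null: `Ω(X)` has null range, and `H` preserves null vectors by
  -- hypothesis.
  have h1 := sub_mem (Omega_mem_nullSpace μ hL hX (quadHam Γ ε f))
    (h _ (Omega_mem_nullSpace μ hL hX f))
  have h2 : Omega n X (quadHam Γ ε f) - quadHam Γ ε (Omega n X f)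
      = (2 * Complex.I) • Omega n (contract X Γ) f := by
    rw [quadHam_apply, quadHam_apply, Omega₂_Omega hΓ, map_add, map_smul]
    module
  rw [h2] at h1
  exact (Submodule.smul_mem_iff _ (by simp)).1 h1

end Plane

end ConstrainedQuadratic

end

open ConstrainedQuadratic in
theorem lemma16 (n : ℕ) (L : Submodule ℝ (PhaseSpace n)) (hL : IsIsotropic L)
    (μ : Measure L) [μ.IsAddHaarMeasure]
    (Γ : PhaseSpace n ⊗[ℝ] PhaseSpace n) (hΓ : Γ ∈ symTensor (n := n) ⊤ ⊤) (ε : ℝ) :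
    (PreservesEquiv L μ (quadHam Γ ε) ↔
      Γ ∈ symTensor (skewOrth L) (skewOrth L) ⊔ symTensor L ⊤) ∧
    (PreservesEquiv L μ (quadHam Γ ε) →
      ∃ Γ' ∈ symTensor (skewOrth L) (skewOrth L), ∃ ε' : ℂ, ε'.re = ε ∧
        ∀ f : Wave n, GaugeEquiv L μ (quadHam Γ ε f) (Omega₂ n Γ' f + ε' • f)) := by
  have key : Γ ∈ symTensor (skewOrth L) (skewOrth L) ⊔ symTensor L ⊤ →
      ∃ Γ' ∈ symTensor (skewOrth L) (skewOrth L), ∃ ε' : ℂ, ε'.re = ε ∧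
        ∀ f : Wave n, quadHam Γ ε f - (Omega₂ n Γ' f + ε' • f) ∈ nullSpace L μ := by
    intro h
    obtain ⟨Γ₁, h₁, Γ₂, h₂, rfl⟩ := Submodule.mem_sup.1 h
    obtain ⟨r, hr⟩ := exists_Omega₂_sub_mem_nullSpace μ hL h₂
    refine ⟨Γ₁, h₁, ε + Complex.I * r, by simp, fun f => ?_⟩
    convert! hr f using 1
    rw [quadHam_apply, Omega₂_add]
    module
  refine ⟨⟨mem_sup_of_preservesEquiv μ hL hΓ ε, fun h => ?_⟩, fun h => ?_⟩
  · obtain ⟨Γ', hΓ', ε', -, hf⟩ := key h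
    refine (preservesEquiv_iff μ hL _).2 fun f hf0 => ?_
    have := add_mem (hf f) (add_mem (Omega₂_mem_nullSpace μ hΓ' hf0)
      (Submodule.smul_mem _ ε' hf0))
    rwa [sub_add_cancel] at this
  · obtain ⟨Γ', hΓ', ε', hε, hf⟩ := key (mem_sup_of_preservesEquiv μ hL hΓ ε h)
    exact ⟨Γ', hΓ', ε', hε, fun f => (gaugeEquiv_iff μ hL _ _).2 (hf f)⟩
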